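/- For a finite poset $R$ with least element $\hat 0$ and greatest element $\hat 1$, write $\mu(R)=\mu_R(\hat 0,\hat 1)$ for its Möbius function. For graded posets $P,Q$ with rank function $\rho$ (minimal elements have rank $0$), the Rees product $P*Q$ is the set of pairs $(p,q)\in P\times Q$ with $\rho(p)\ge\rho(q)$, ordered by $(p,q)\le(p',q')$ if and only if $p\le p'$, $q\le q'$ and $\rho(p')-\rho(p)\ge\rho(q')-\rho(q)$. If $P$ has a least element $\hat 0$, let $\operatorname{Rees}(P,Q)=((P-\{\hat 0\})*Q)\cup\{\hat 0,\hat 1\}$, where a new least element and a new greatest element are adjoined to $(P-\{\hat 0\})*Q$ and $P-\{\hat 0\}$ is graded with its minimal elements in rank $0$. Let $\mathscr C_n$ be the cubical lattice, that is, the face lattice of the $n$-dimensional cube: its elements are the vectors in $\{0,1,*\}^n$, ordered coordinatewise by $0<*$ and $1<*$, together with a least element (the empty face). Let $C_{n+1}$ be the chain with $n+1$ elements. **Theorem.** For every integer $n\ge 0$, $$\mu(\operatorname{Rees}(\mathscr C_n,C_{n+1}))=(-1)^n\sum_{c}2^{\,n-c_1}\binom{n}{c_1,\ldots,c_k}\,c_1\prod_{i=2}^{k}(c_i-1),$$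 where the sum is over all compositions $c=(c_1,\ldots,c_k)$ of $n$ into positive integers with $1\le k\le n$ (for $n=0$ the sum is empty and equals $0$). -/

import Mathlib

namespace ReesCube

/-! ### The Möbius function -/

/-- The Möbius number `μ(P) = μ_P(⊥, ⊤)` of a finite poset with least and greatest element. -/
noncomputable def mobius (P : Type*) [PartialOrder P] [BoundedOrder P] [Finite P] : ℤ :=
  letI : Fintype P := Fintype.ofFinite P
  letI : DecidableEq P := Classical.decEq P
  letI : DecidableLE P := Classical.decRel _
  letI : DecidableLT P := Classical.decRel _
  letI : LocallyFiniteOrder P := Fintype.toLocallyFiniteOrder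
  IncidenceAlgebra.mu ℤ (⊥ : P) ⊤

/-! ### The Rees product

A graded poset is a poset with a rank function `grade ℕ` that is strictly monotone, increases by
one along covers, and vanishes on minimal elements (`GradeMinOrder ℕ`). -/

/-- The underlying set of the Rees product `P * Q`: pairs `(p, q)` with `ρ(p) ≥ ρ(q)`. -/
@[ext]
structure ReesProduct (P Q : Type*) [PartialOrder P] [PartialOrder Q]
    [GradeMinOrder ℕ P] [GradeMinOrder ℕ Q] where
  fst : P
  snd : Q
  grade_le : grade ℕ snd ≤ grade ℕ fst

section ReesProduct

variable {P Q : Type*} [PartialOrder P] [PartialOrder Q] [GradeMinOrder ℕ P] [GradeMinOrder ℕ Q]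

/-- `(p, q) ≤ (p', q')` iff `p ≤ p'`, `q ≤ q'` and `ρ(p') - ρ(p) ≥ ρ(q') - ρ(q)` (in `ℤ`). -/
instance ReesProduct.instPartialOrder : PartialOrder (ReesProduct P Q) where
  le x y := x.fst ≤ y.fst ∧ x.snd ≤ y.snd ∧
    (grade ℕ y.fst : ℤ) - (grade ℕ x.fst : ℤ) ≥ (grade ℕ y.snd : ℤ) - (grade ℕ x.snd : ℤ)
  le_refl x := ⟨le_rfl, le_rfl, by simp⟩
  le_trans x y z h h' := ⟨h.1.trans h'.1, h.2.1.trans h'.2.1, by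
    have h1 := h.2.2
    have h2 := h'.2.2
    linarith⟩
  le_antisymm x y h h' := ReesProduct.ext (h.1.antisymm h'.1) (h.2.1.antisymm h'.2.1)

instance ReesProduct.instFinite [Finite P] [Finite Q] : Finite (ReesProduct P Q) :=
  Finite.of_injective (fun x : ReesProduct P Q => (x.fst, x.snd)) fun x y h => by
    simp only [Prod.mk.injEq] at h
    exact ReesProduct.ext h.1 h.2

end ReesProduct

/-- The subposet `P - {⊥}`. -/
abbrev NonBot (P : Type*) [PartialOrder P] [OrderBot P] : Type _ := {x : P // x ≠ ⊥}

/-- `P - {⊥}` is graded, an element having there one less than its rank in `P`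
(so that its minimal elements, the atoms of `P`, have rank `0`). -/
instance NonBot.instGradeMinOrder (P : Type*) [PartialOrder P] [OrderBot P] [GradeMinOrder ℕ P] :
    GradeMinOrder ℕ (NonBot P) where
  grade x := grade ℕ x.1 - 1
  grade_strictMono := by
    intro a b h
    have h0 : grade ℕ (⊥ : P) < grade ℕ a.1 := grade_strictMono (bot_lt_iff_ne_bot.2 a.2)
    have h1 : grade ℕ a.1 < grade ℕ b.1 := grade_strictMono h
    show grade ℕ a.1 - 1 < grade ℕ b.1 - 1
    omega
  covBy_grade := by
    intro a b h
    have h0 : grade ℕ (⊥ : P) < grade ℕ a.1 := grade_strictMono (bot_lt_iff_ne_bot.2 a.2)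
    have hab : a.1 ⋖ b.1 :=
      ⟨h.1, fun c hac hcb =>
        h.2 (c := ⟨c, (bot_le.trans_lt hac).ne'⟩) hac hcb⟩
    have h1 : grade ℕ a.1 ⋖ grade ℕ b.1 := hab.grade ℕ
    rw [Nat.covBy_iff_add_one_eq] at h1 ⊢
    omega
  isMin_grade := by
    intro a ha
    have hab : (⊥ : P) ⋖ a.1 :=
      ⟨bot_lt_iff_ne_bot.2 a.2, fun c hc hca =>
        ha.not_lt (b := (⟨c, hc.ne'⟩ : NonBot P)) hca⟩
    have h1 : grade ℕ (⊥ : P) ⋖ grade ℕ a.1 := hab.grade ℕ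
    rw [grade_bot, Nat.covBy_iff_add_one_eq] at h1
    have h2 : grade ℕ a.1 = 1 := by rw [← h1]; rfl
    rw [h2]
    exact isMin_bot

/-- `Rees(P, Q) = ((P - {⊥}) * Q) ∪ {0̂, 1̂}`, with a new least element `0̂` and a new
greatest element `1̂`. -/
abbrev Rees (P Q : Type*) [PartialOrder P] [OrderBot P] [PartialOrder Q]
    [GradeMinOrder ℕ P] [GradeMinOrder ℕ Q] : Type _ :=
  WithBot (WithTop (ReesProduct (NonBot P) Q))

/-! ### The chain -/

/-- The `m`-element chain `Fin m`, graded by the value. -/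
instance instGradeMinOrderFin (m : ℕ) : GradeMinOrder ℕ (Fin m) where
  grade i := (i : ℕ)
  grade_strictMono := Fin.val_strictMono
  covBy_grade a b h := by
    rw [Nat.covBy_iff_add_one_eq]
    have h1 : (a : ℕ) < b := h.1
    by_contra h2
    have h3 : (a : ℕ) + 1 < b := by omega
    exact h.2 (c := ⟨a + 1, h3.trans b.2⟩) (Nat.lt_succ_self (a : ℕ)) h3
  isMin_grade a ha := by
    have h1 : (a : ℕ) = 0 := by
      by_contra h2
      exact ha.not_lt (b := ⟨0, by omega⟩) (Nat.pos_of_ne_zero h2)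
    rw [h1]
    exact isMin_bot

/-! ### The cubical lattice -/

/-- The nonempty faces of the interval `[0, 1]`: the vertices `0` and `1`, and `*`, the interval
itself. -/
inductive Coord where
  | zero
  | one
  | star
  deriving DecidableEq

instance Coord.instFintype : Fintype Coord where
  elems := {.zero, .one, .star}
  complete a := by cases a <;> simp

/-- Faces of `[0, 1]` are ordered by inclusion: `0 < *` and `1 < *`. -/
instance Coord.instPartialOrder : PartialOrder Coord where
  le a b := a = b ∨ b = .star
  le_refl a := Or.inl rfl
  le_trans a b c h h' := by
    rcases h' with rfl | h'
    · exact h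
    · exact Or.inr h'
  le_antisymm a b h h' := by
    rcases h with h | h
    · exact h
    · rcases h' with h' | h'
      · exact h'.symm
      · exact h'.trans h.symm

/-- The nonempty faces of the `n`-cube, encoded as vectors in `{0, 1, *}ⁿ` and ordered by inclusion,
that is, coordinatewise. -/
abbrev CubeFace (n : ℕ) : Type := Fin n → Coord

/-- The dimension of a face is its number of stars. -/
def dim {n : ℕ} (x : CubeFace n) : ℕ := (Finset.univ.filter fun i => x i = .star).card

/-- The face lattice of the `n`-cube: the nonempty faces together with the empty face `⊥`. -/
abbrev CubicalLattice (n : ℕ) : Type := WithBot (CubeFace n)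

/-- The rank function of the cubical lattice: `0` on the empty face, `dim + 1` on the others. -/
def cubicalRank {n : ℕ} : CubicalLattice n → ℕ
  | none => 0
  | some x => dim x + 1

theorem dim_strictMono {n : ℕ} : StrictMono (dim (n := n)) := by
  intro x y h
  obtain ⟨hle, i, hi⟩ := Pi.lt_def.1 h
  apply Finset.card_lt_card
  rw [Finset.ssubset_iff_of_subset]
  · refine ⟨i, ?_, ?_⟩
    · have h1 : x i = y i ∨ y i = .star := hi.le
      simpa using h1.resolve_left hi.ne
    · have h1 : x i = y i ∨ y i = .star := hi.le
      have h2 : x i ≠ .star := fun h3 => hi.ne (h3.trans (h1.resolve_left hi.ne).symm)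
      simpa using h2
  · intro j hj
    have hj' : x j = .star := by simpa using hj
    have h1 : x j = y j ∨ y j = .star := hle j
    have h2 : y j = .star := h1.elim (fun h => h ▸ hj') id
    simpa using h2

theorem dim_covBy {n : ℕ} {x y : CubeFace n} (h : x ⋖ y) : dim y = dim x + 1 := by
  obtain ⟨hle, i, hi⟩ := Pi.lt_def.1 h.1
  have h1 : x i = y i ∨ y i = .star := hi.le
  have hy : y i = .star := h1.resolve_left hi.ne
  have hx : x i ≠ .star := fun h3 => hi.ne (h3.trans hy.symm)
  have hyx : y = Function.update x i .star := by
    by_contra hne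
    refine h.2 (c := Function.update x i .star) ?_ (lt_of_le_of_ne ?_ (Ne.symm hne))
    · refine Pi.lt_def.2 ⟨fun j => ?_, i, ?_⟩
      · by_cases hj : j = i
        · subst hj
          exact Or.inr (by simp)
        · exact Or.inl (by simp [hj])
      · refine lt_of_le_of_ne (Or.inr (by simp)) (by simpa using hx)
    · intro j
      by_cases hj : j = i
      · subst hj
        exact Or.inr hy
      · simpa [hj] using hle j
  have h2 : (Finset.univ.filter fun j => y j = .star)
      = insert i (Finset.univ.filter fun j => x j = .star) := by
    ext j
    by_cases hj : j = i
    · subst hj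
      simp [hy]
    · simp [hyx, hj]
  rw [dim, h2, Finset.card_insert_of_notMem (by simpa using hx), dim]

theorem dim_of_isMin {n : ℕ} {x : CubeFace n} (h : IsMin x) : dim x = 0 := by
  rw [dim, Finset.card_eq_zero, Finset.filter_eq_empty_iff]
  intro i _ hi
  refine h.not_lt (b := Function.update x i .zero) (Pi.lt_def.2 ⟨fun j => ?_, i, ?_⟩)
  · by_cases hj : j = i
    · subst hj
      exact Or.inr hi
    · exact Or.inl (by simp [hj])
  · exact lt_of_le_of_ne (Or.inr hi) (by simp [hi])

instance CubicalLattice.instGradeMinOrder (n : ℕ) : GradeMinOrder ℕ (CubicalLattice n) where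
  grade := cubicalRank
  grade_strictMono := by
    intro a b h
    induction b using WithBot.recBotCoe with
    | bot => exact absurd h not_lt_bot
    | coe b =>
      induction a using WithBot.recBotCoe with
      | bot => exact Nat.succ_pos _
      | coe a => exact Nat.succ_lt_succ (dim_strictMono (WithBot.coe_lt_coe.1 h))
  covBy_grade := by
    intro a b h
    rw [Nat.covBy_iff_add_one_eq]
    induction b using WithBot.recBotCoe with
    | bot => exact absurd h.1 not_lt_bot
    | coe b =>
      induction a using WithBot.recBotCoe with
      | bot =>
        have h1 : dim b = 0 := dim_of_isMin (WithBot.bot_covBy_coe.1 h)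
        show 0 + 1 = dim b + 1
        rw [h1]
      | coe a =>
        have h1 : dim b = dim a + 1 := dim_covBy (WithBot.coe_covBy_coe.1 h)
        show dim a + 1 + 1 = dim b + 1
        rw [h1]
  isMin_grade := by
    intro a ha
    rw [isMin_iff_eq_bot] at ha
    subst ha
    exact isMin_bot

end ReesCube

namespace ReesCube

open Finset PowerSeries

/-! Let `N p` be the sum of `μ(0̂, (p, q))` over the chain coordinate `q`. Fix a face `x` and add
the defining relations of `μ` at all `(x, r)`. A pair `(p, q)` with `p ≤ x` lies below exactly `dim
x - dim p + 1` of these elements, whatever `q` is, so `N` satisfies a triangular system on the face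
poset of the cube alone (`exists_mobius_rees_cube_eq`).

Since a `d`-face has `2 ^ (d - e) * d.choose e` faces of dimension `e` (`sum_faces`), the system is
a binomial convolution in the dimension. Its solution has exponential generating function `F` with
`F (1 + 2X) e^{2X} = -(1 + X) e^X` (`eq_coeff_faceSeries`). The Möbius numbers then have generating
function `-(e^X + F e^{2X}) = -X e^X / (1 + 2X)`.

On the other side, `2 ^ (n - c₁)` splits over the later blocks, so the composition sum has
generating function `W = X e^X / (1 - ∑ 2^b (b - 1) X^b / b!) = X e^{-X} / (1 - 2X)`
(`weightSeries_mul`). Substituting `-X` for `X` supplies the sign `(-1) ^ n` and gives the same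
series (`neg_exp_add_faceSeries`). -/

/-! ### Möbius numbers of posets with adjoined bounds -/

/-- The Möbius number as the value at the top of the function `x ↦ μ(⊥, x)`. -/
theorem exists_mobius_values (R : Type*) [PartialOrder R] [BoundedOrder R] [Fintype R]
    [DecidableLE R] :
    ∃ f : R → ℤ, f ⊥ = 1 ∧ f ⊤ = mobius R ∧
      ∀ b : R, b ≠ ⊥ → ∑ x, (if x ≤ b then f x else 0) = 0 := by
  let dEq : DecidableEq R := Classical.decEq R
  let locFin : LocallyFiniteOrder R :=
    @Fintype.toLocallyFiniteOrder R _ (Fintype.ofFinite R) (Classical.decRel _) (Classical.decRel _)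
  refine ⟨fun x => IncidenceAlgebra.mu ℤ (⊥ : R) x, IncidenceAlgebra.mu_self _, rfl, ?_⟩
  intro b hb
  have h := IncidenceAlgebra.sum_Icc_mu_right (𝕜 := ℤ) (⊥ : R) b
  rw [if_neg hb.symm] at h
  rw [← Finset.sum_filter]
  refine Eq.trans (Finset.sum_congr ?_ fun _ _ => rfl) h
  ext x
  simp

/-- The Möbius number of the poset obtained from `Q` by adjoining `0̂` and `1̂`, through the values
`μ(0̂, x)` for `x` in `Q`. -/
theorem exists_mobius_eq (Q : Type*) [PartialOrder Q] [Fintype Q] [DecidableLE Q] :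
    ∃ g : Q → ℤ, (∀ b, ∑ y with y ≤ b, g y = -1) ∧
      mobius (WithBot (WithTop Q)) = -(1 + ∑ y, g y) := by
  classical
  let : Fintype (WithTop Q) := inferInstanceAs (Fintype (Option Q))
  let : Fintype (WithBot (WithTop Q)) := inferInstanceAs (Fintype (Option (WithTop Q)))
  obtain ⟨f, hbot, htop, hf⟩ := exists_mobius_values (WithBot (WithTop Q))
  have hsum : ∀ F : WithBot (WithTop Q) → ℤ,
      ∑ x, F x = F ⊥ + (F ⊤ + ∑ y : Q, F ((y : WithTop Q) : WithBot (WithTop Q))) := fun F =>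
    (Fintype.sum_option (α := WithTop Q) F).trans
      (congrArg (F ⊥ + ·) (Fintype.sum_option (α := Q) fun x : WithTop Q => F x))
  refine ⟨fun y => f ((y : WithTop Q) : WithBot (WithTop Q)), fun b => ?_, ?_⟩
  · have h := hf ((b : WithTop Q) : WithBot (WithTop Q)) WithBot.coe_ne_bot
    have h1 : ¬ ((⊤ : WithBot (WithTop Q)) ≤ ((b : WithTop Q) : WithBot (WithTop Q))) := by
      rw [← WithBot.coe_top, WithBot.coe_le_coe]
      simp
    rw [hsum, if_pos bot_le, if_neg h1, hbot] at h
    simp only [WithBot.coe_le_coe, WithTop.coe_le_coe, ← Finset.sum_filter] at h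
    linarith
  · have h := hf ⊤ (by rw [← WithBot.coe_top]; exact WithBot.coe_ne_bot)
    rw [hsum] at h
    simp only [le_top, if_true, hbot, htop] at h
    linarith

/-! ### Eliminating the chain coordinate -/

/-- The Rees product of the nonempty faces of the cube with a long enough chain consists of the
pairs `(p, q)` with `q ≤ dim p`. -/
def reesCubeEquiv (n : ℕ) :
    ReesProduct (NonBot (CubicalLattice n)) (Fin (n + 1)) ≃
      (Σ p : CubeFace n, Fin (dim p + 1)) where
  toFun x := ⟨WithBot.unbot x.fst.1 x.fst.2, ⟨x.snd, by
    obtain ⟨⟨p, hp⟩, q, h⟩ := x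
    induction p using WithBot.recBotCoe with
    | bot => exact absurd rfl hp
    | coe p => exact Nat.lt_succ_of_le h⟩⟩
  invFun y := ⟨⟨(y.1 : CubicalLattice n), WithBot.coe_ne_bot⟩,
    -- A face has dimension at most `n`, so a chain with `n + 1` elements never truncates `q ≤ dim
    -- p`.
    ⟨y.2, y.2.2.trans_le (Nat.succ_le_succ ((Finset.card_le_univ _).trans (by simp)))⟩,
    Nat.le_of_lt_succ y.2.2⟩
  left_inv x := by
    obtain ⟨⟨p, hp⟩, q, h⟩ := x
    induction p using WithBot.recBotCoe with
    | bot => exact absurd rfl hp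
    | coe p => rfl
  right_inv y := rfl

theorem reesCubeEquiv_symm_le {n : ℕ} (x y : Σ p : CubeFace n, Fin (dim p + 1)) :
    (reesCubeEquiv n).symm x ≤ (reesCubeEquiv n).symm y ↔
      x.1 ≤ y.1 ∧ (x.2 : ℕ) ≤ y.2 ∧ (y.2 : ℕ) + dim x.1 ≤ x.2 + dim y.1 := by
  have h1 : (reesCubeEquiv n).symm x ≤ (reesCubeEquiv n).symm y ↔
      (x.1 : CubicalLattice n) ≤ y.1 ∧ (x.2 : ℕ) ≤ y.2 ∧
        ((dim y.1 : ℕ) : ℤ) - ((dim x.1 : ℕ) : ℤ) ≥ ((y.2 : ℕ) : ℤ) - ((x.2 : ℕ) : ℤ) := Iff.rfl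
  rw [h1, WithBot.coe_le_coe]
  refine and_congr_right fun _ => and_congr_right fun _ => ?_
  omega

theorem dim_mono {n : ℕ} {x y : CubeFace n} (h : x ≤ y) : dim x ≤ dim y :=
  dim_strictMono.monotone h

/-- The admissible `r` run from `q` to `q + (d - e)`; the bound `r ≤ d` is automatic because `q ≤
e`. Hence the count is independent of `q`. -/
theorem card_shifted_interval {d e q : ℕ} (he : e ≤ d) (hq : q ≤ e) :
    #{r : Fin (d + 1) | q ≤ (r : ℕ) ∧ (r : ℕ) + e ≤ q + d} = d - e + 1 := by
  have : (Finset.univ.filter fun r : Fin (d + 1) => q ≤ (r : ℕ) ∧ (r : ℕ) + e ≤ q + d).map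
      Fin.valEmbedding = Finset.Icc q (q + (d - e)) := by
    ext k
    simp only [Finset.mem_map, Finset.mem_filter, Finset.mem_univ, true_and,
      Fin.valEmbedding_apply, Finset.mem_Icc]
    constructor
    · rintro ⟨r, hr, rfl⟩
      omega
    · intro hk
      exact ⟨⟨k, by omega⟩, by simp only; omega, rfl⟩
  rw [← Finset.card_map, this, Nat.card_Icc]
  omega

open Classical in
/-- The Möbius number of `Rees(𝒞ₙ, C_{n+1})`, through the sums over the chain coordinate of the
values `μ(0̂, (p, q))`. -/
theorem exists_mobius_rees_cube_eq (n : ℕ) :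
    ∃ N : CubeFace n → ℤ,
      (∀ x, ∑ p with p ≤ x, ((dim x - dim p + 1 : ℕ) : ℤ) * N p = -(dim x + 1)) ∧
      mobius (Rees (CubicalLattice n) (Fin (n + 1))) = -(1 + ∑ p, N p) := by
  let : Fintype (ReesProduct (NonBot (CubicalLattice n)) (Fin (n + 1))) := Fintype.ofFinite _
  obtain ⟨g, hg, hmu⟩ := exists_mobius_eq (ReesProduct (NonBot (CubicalLattice n)) (Fin (n + 1)))
  refine ⟨fun p => ∑ q : Fin (dim p + 1), g ((reesCubeEquiv n).symm ⟨p, q⟩), fun x => ?_, ?_⟩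
  · have h : ∀ r : Fin (dim x + 1), ∑ p with p ≤ x, ∑ q : Fin (dim p + 1),
        (if (q : ℕ) ≤ r ∧ (r : ℕ) + dim p ≤ q + dim x then
          g ((reesCubeEquiv n).symm ⟨p, q⟩) else 0) = -1 := by
      intro r
      rw [← hg ((reesCubeEquiv n).symm ⟨x, r⟩), Finset.sum_filter, Finset.sum_filter,
        ← (reesCubeEquiv n).symm.sum_comp, Fintype.sum_sigma]
      refine Finset.sum_congr rfl fun p _ => ?_
      simp only [reesCubeEquiv_symm_le]
      by_cases hp : p ≤ x <;> simp [hp]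
    -- Add the relations over all `r`; after exchanging sums, each `(p, q)` is weighted by the
    -- number of `r` with `(p, q) ≤ (x, r)`.
    have h2 := Finset.sum_congr (rfl : (Finset.univ : Finset (Fin (dim x + 1))) = _)
      fun r _ => h r
    rw [Finset.sum_comm] at h2
    simp only [Finset.sum_const, Finset.card_univ, Fintype.card_fin, nsmul_eq_mul] at h2
    push_cast at h2 ⊢
    rw [show -((dim x : ℤ) + 1) = ((dim x : ℤ) + 1) * -1 by ring, ← h2]
    refine Finset.sum_congr rfl fun p hp => ?_
    rw [Finset.sum_comm, Finset.mul_sum]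
    refine Finset.sum_congr rfl fun q _ => ?_
    rw [← Finset.sum_filter, Finset.sum_const,
      card_shifted_interval (dim_mono (Finset.mem_filter.1 hp).2) (Nat.le_of_lt_succ q.2),
      nsmul_eq_mul]
    push_cast
    rfl
  · rw [hmu, ← (reesCubeEquiv n).symm.sum_comp, Fintype.sum_sigma]

/-! ### Counting faces of the cube by dimension -/

open Classical in
open Polynomial in
-- The sum factors over coordinates: a star of `x` may stay a star (`X`) or become `0` or `1` (`2`),
-- while a fixed coordinate contributes `1`.
theorem sum_faces_X_pow {n : ℕ} (x : CubeFace n) :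
    ∑ p with p ≤ x, (Polynomial.X : ℚ[X]) ^ dim p =
      (Polynomial.X + Polynomial.C 2) ^ dim x := by
  have h1 : (Finset.univ.filter fun p => p ≤ x)
      = Fintype.piFinset fun i => Finset.univ.filter fun c => c ≤ x i := by
    ext p
    simp [Pi.le_def]
  have h2 : ∀ p : CubeFace n, (Polynomial.X : ℚ[X]) ^ dim p =
      ∏ i, if p i = Coord.star then (Polynomial.X : ℚ[X]) else 1 := by
    intro p
    rw [Finset.prod_ite]
    simp [dim]
  rw [h1, Finset.sum_congr rfl fun p _ => h2 p,
    ← Finset.prod_univ_sum (fun i => Finset.univ.filter fun c => c ≤ x i)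
      (fun _ c => if c = Coord.star then (Polynomial.X : ℚ[X]) else 1)]
  have h3 : ∀ i, (∑ c with c ≤ x i, if c = Coord.star then (Polynomial.X : ℚ[X]) else 1) =
      if x i = Coord.star then Polynomial.X + Polynomial.C 2 else 1 := by
    intro i
    have hu : (Finset.univ : Finset Coord) = {.zero, .one, .star} := rfl
    have hle : ∀ a b : Coord, a ≤ b ↔ a = b ∨ b = .star := fun _ _ => Iff.rfl
    rw [hu, Finset.sum_filter]
    cases x i <;> simp [hle]
    rw [show (Polynomial.C 2 : ℚ[X]) = 1 + 1 by rw [← Polynomial.C_1, ← Polynomial.C_add]; norm_num]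
    ring
  rw [Finset.prod_congr rfl fun i _ => h3 i, Finset.prod_ite]
  simp [dim]

open Classical in
/-- A face of dimension `d` of the cube has `2 ^ (d - e) * d.choose e` faces of dimension `e`. -/
theorem sum_faces {n : ℕ} (x : CubeFace n) (h : ℕ → ℚ) :
    ∑ p with p ≤ x, h (dim p) =
      ∑ e ∈ range (dim x + 1), 2 ^ (dim x - e) * ((dim x).choose e : ℚ) * h e := by
  have h1 : ∀ e, 2 ^ (dim x - e) * ((dim x).choose e : ℚ) =
      ∑ p with p ≤ x, if e = dim p then 1 else 0 := by
    intro e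
    rw [← Polynomial.coeff_X_add_C_pow, ← sum_faces_X_pow, Polynomial.finsetSum_coeff]
    simp only [Polynomial.coeff_X_pow]
  simp only [h1, Finset.sum_mul]
  rw [Finset.sum_comm]
  refine Finset.sum_congr rfl fun p hp => ?_
  have := dim_mono (Finset.mem_filter.1 hp).2
  simp only [ite_mul, one_mul, zero_mul, Finset.sum_ite_eq', Finset.mem_range]
  rw [if_pos (by omega)]

/-! ### Generating functions of compositions -/

/-- Prepend a block of size `p.1 + 1` to a composition of `p.2`. -/
def consComposition {n : ℕ} (x : Σ p : antidiagonal n, Composition p.1.2) :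
    Composition (n + 1) where
  blocks := (x.1.1.1 + 1) :: x.2.blocks
  blocks_pos {i} hi := by
    rcases List.mem_cons.1 hi with rfl | hi
    · exact Nat.succ_pos _
    · exact x.2.blocks_pos hi
  blocks_sum := by
    have := mem_antidiagonal.1 x.1.2
    rw [List.sum_cons, x.2.blocks_sum]
    omega

theorem consComposition_bijective (n : ℕ) : Function.Bijective (consComposition (n := n)) := by
  constructor
  · rintro ⟨⟨⟨a, b⟩, h⟩, c⟩ ⟨⟨⟨a', b'⟩, h'⟩, c'⟩ heq
    have h1 := congrArg Composition.blocks heq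
    simp only [consComposition, List.cons.injEq, Nat.add_right_cancel_iff] at h1
    obtain ⟨rfl, h2⟩ := h1
    have hb : b = b' := c.blocks_sum.symm.trans ((congrArg List.sum h2).trans c'.blocks_sum)
    subst hb
    rw [Composition.ext h2]
  · intro c
    obtain ⟨l, hpos, hsum⟩ := c
    cases l with
    | nil => simp at hsum
    | cons a l =>
      have ha : 0 < a := hpos List.mem_cons_self
      rw [List.sum_cons] at hsum
      refine ⟨⟨⟨(a - 1, l.sum), mem_antidiagonal.2 (by simp only; omega)⟩,
        ⟨l, fun hi => hpos (List.mem_cons_of_mem _ hi), rfl⟩⟩, ?_⟩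
      ext1
      simp only [consComposition, List.cons.injEq, and_true]
      omega

theorem sum_composition_succ {R : Type*} [AddCommMonoid R] (n : ℕ) (h : List ℕ → R) :
    ∑ c : Composition (n + 1), h c.blocks =
      ∑ p ∈ antidiagonal n, ∑ c : Composition p.2, h ((p.1 + 1) :: c.blocks) := by
  rw [← (Function.Bijective.sum_comp (consComposition_bijective n) fun c => h c.blocks),
    Fintype.sum_sigma]
  exact Finset.sum_coe_sort (antidiagonal n)
    (fun p => ∑ c : Composition p.2, h ((p.1 + 1) :: c.blocks))

/-- The generating function of compositions with multiplicative weights on the blocks. -/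
theorem composition_genFun_eq {R : Type*} [CommRing R] (w : ℕ → R) :
    PowerSeries.mk (fun n => ∑ c : Composition n, (c.blocks.map w).prod) *
      (1 - X * PowerSeries.mk fun n => w (n + 1)) = 1 := by
  rw [mul_sub, mul_one, sub_eq_iff_eq_add]
  ext n
  cases n with
  | zero =>
    have : ∀ c : Composition 0, c.blocks = [] := fun c => c.blocks_eq_nil.2 rfl
    simp [this, composition_card]
  | succ n =>
    rw [map_add, mul_left_comm, coeff_succ_X_mul, coeff_mk, mul_comm,
      sum_composition_succ n fun l => (l.map w).prod, coeff_mul]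
    simp [Finset.mul_sum, coeff_one]

/-- The generating function of compositions with multiplicative weights on the blocks, the first
block having a weight of its own. -/
theorem composition_head_genFun_eq {R : Type*} [CommRing R] (v w : ℕ → R) (h : List ℕ → R)
    (h0 : h [] = 0) (h1 : ∀ a l, h (a :: l) = v a * (l.map w).prod) :
    PowerSeries.mk (fun n => ∑ c : Composition n, h c.blocks) *
      (1 - X * PowerSeries.mk fun n => w (n + 1)) = X * PowerSeries.mk fun n => v (n + 1) := by
  have key : PowerSeries.mk (fun n => ∑ c : Composition n, h c.blocks) =
      X * (PowerSeries.mk fun n => v (n + 1)) *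
        PowerSeries.mk (fun n => ∑ c : Composition n, (c.blocks.map w).prod) := by
    ext n
    cases n with
    | zero =>
      have : ∀ c : Composition 0, c.blocks = [] := fun c => c.blocks_eq_nil.2 rfl
      simp [this, h0]
    | succ n =>
      rw [mul_assoc, coeff_succ_X_mul, coeff_mk, sum_composition_succ n h, coeff_mul]
      simp [Finset.mul_sum, h1]
  rw [key, mul_assoc, composition_genFun_eq, mul_one]

/-! ### The weights of the theorem -/

open Nat in
/-- The weight of a composition in the theorem, divided by `n!`. -/
def blocksWeight : List ℕ → ℚ
  | [] => 0
  | a :: l => (a : ℚ) / a ! * (l.map fun b : ℕ => 2 ^ b * ((b : ℚ) - 1) / b !).prod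

open Nat in
-- The multinomial coefficient is `n!` over the product of the block factorials, and `n - c₁` is the
-- sum of the later blocks, so the weight is multiplicative in the blocks.
theorem blocksWeight_eq {n : ℕ} (c : Composition n) (hc : 0 < c.length) :
    (2 : ℚ) ^ (n - c.blocksFun ⟨0, hc⟩) * (Nat.multinomial Finset.univ c.blocksFun : ℚ) *
      (c.blocksFun ⟨0, hc⟩ : ℚ) *
        ∏ i : Fin c.length with 1 ≤ i.val, ((c.blocksFun i : ℚ) - 1) =
      n ! * blocksWeight c.blocks := by
  have hm : (Nat.multinomial Finset.univ c.blocksFun : ℚ) = n ! / ∏ i, ((c.blocksFun i)! : ℚ) := by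
    have h1 := Nat.multinomial_spec Finset.univ c.blocksFun
    rw [c.sum_blocksFun] at h1
    rw [eq_div_iff (by exact_mod_cast Finset.prod_ne_zero_iff.2 fun i _ => Nat.factorial_ne_zero _),
      ← h1]
    push_cast
    ring
  rw [hm]
  obtain ⟨a, l, hl⟩ : ∃ a l, c.blocks = a :: l := List.exists_cons_of_ne_nil (by
    intro h; rw [← c.blocks_length, h] at hc; simp at hc)
  obtain ⟨bl, hpos, hsum⟩ := c
  simp only at hl
  subst hl
  have hs : n - a = l.sum := by rw [← hsum]; simp
  have h1 : ∀ f : ℕ → ℚ, ∏ i : Fin (l.length + 1), f ((a :: l).get i) =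
      f a * (l.map f).prod := fun f =>
    (Fin.prod_univ_succ _).trans (congrArg (f a * ·) (Fin.prod_univ_fun_getElem l f))
  have h2 : ∏ i : Fin (l.length + 1) with 1 ≤ i.val, (((a :: l).get i : ℚ) - 1) =
      (l.map fun b : ℕ => (b : ℚ) - 1).prod := by
    rw [Finset.prod_filter, Fin.prod_univ_succ, if_neg (by simp), one_mul]
    simp only [Fin.val_succ, le_add_iff_nonneg_left, zero_le, if_true]
    exact Fin.prod_univ_fun_getElem l fun b => (b : ℚ) - 1
  have h3 : ∀ l : List ℕ, (l.map fun b : ℕ => (2 : ℚ) ^ b * ((b : ℚ) - 1) / b !).prod =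
      2 ^ l.sum * (l.map fun b : ℕ => (b : ℚ) - 1).prod / (l.map fun b : ℕ => (b ! : ℚ)).prod := by
    intro l
    induction l with
    | nil => simp
    | cons b l ih =>
      simp only [List.map_cons, List.prod_cons, List.sum_cons, ih]
      rw [pow_add]
      field_simp
  change (2 : ℚ) ^ (n - a) * (n ! / ∏ i : Fin (l.length + 1), (((a :: l).get i)! : ℚ)) * a *
    ∏ i : Fin (l.length + 1) with 1 ≤ i.val, (((a :: l).get i : ℚ) - 1) = n ! * blocksWeight (a :: l)
  rw [h1 fun b => (b ! : ℚ), h2, hs, blocksWeight, h3]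
  field_simp

open Nat in
theorem mk_add_one_mul_pow_div_factorial (r : ℚ) :
    PowerSeries.mk (fun k => ((k : ℚ) + 1) * r ^ k / k !) =
      (1 + C r * X) * rescale r (exp ℚ) := by
  ext k
  rw [add_mul, one_mul, mul_assoc, map_add, coeff_C_mul]
  cases k with
  | zero => simp
  | succ k =>
    rw [coeff_succ_X_mul]
    simp only [coeff_mk, coeff_rescale, coeff_exp, Nat.factorial_succ, Algebra.algebraMap_self,
      RingHom.id_apply]
    push_cast
    field_simp
    ring

open Nat in
-- Extended to `b = 0`, the series `∑ 2^b (b - 1) X^b / b!` is `(2X - 1) e^{2X}`; its constant term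
-- `-1` accounts for the leading `1`.
theorem one_sub_X_mul_mk_block_weight :
    (1 - X * PowerSeries.mk fun n => (2 : ℚ) ^ (n + 1) * (((n + 1 : ℕ) : ℚ) - 1) / (n + 1)!) =
      (1 - 2 * X) * exp ℚ ^ 2 := by
  rw [exp_pow_eq_rescale_exp, show (2 : ℚ⟦X⟧) = C 2 from (map_ofNat C 2).symm]
  ext k
  rw [sub_mul, one_mul, mul_assoc, map_sub, map_sub, coeff_C_mul]
  cases k with
  | zero => simp
  | succ k =>
    rw [coeff_succ_X_mul, coeff_succ_X_mul]
    simp only [coeff_mk, coeff_rescale, coeff_exp, Nat.factorial_succ, Algebra.algebraMap_self,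
      RingHom.id_apply, coeff_one]
    push_cast
    field_simp
    simp
    ring

open Nat in
theorem X_mul_mk_head_weight :
    (X * PowerSeries.mk fun n => ((n + 1 : ℕ) : ℚ) / (n + 1)!) = X * exp ℚ := by
  congr 1
  ext k
  simp only [coeff_mk, coeff_exp, Nat.factorial_succ, Algebra.algebraMap_self, RingHom.id_apply]
  push_cast
  field_simp

/-- The exponential generating function of the right hand side, up to the sign `(-1) ^ n`. -/
noncomputable def weightSeries : ℚ⟦X⟧ :=
  PowerSeries.mk fun n => ∑ c : Composition n, blocksWeight c.blocks

theorem weightSeries_mul : weightSeries * ((1 - 2 * X) * exp ℚ ^ 2) = X * exp ℚ := by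
  rw [← one_sub_X_mul_mk_block_weight, ← X_mul_mk_head_weight]
  exact composition_head_genFun_eq (fun a => (a : ℚ) / a.factorial)
    (fun b => 2 ^ b * ((b : ℚ) - 1) / b.factorial) blocksWeight rfl fun _ _ => rfl

/-! ### Solving the system and comparing the two series -/

/-- The exponential generating function of the chain sums of the values `μ(0̂, (p, q))`. -/
noncomputable def faceSeries : ℚ⟦X⟧ :=
  -((1 + X) * exp ℚ) * ((1 + 2 * X) * exp ℚ ^ 2)⁻¹

theorem faceSeries_mul : faceSeries * ((1 + 2 * X) * exp ℚ ^ 2) = -((1 + X) * exp ℚ) := by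
  rw [faceSeries, mul_assoc, PowerSeries.inv_mul_cancel, mul_one]
  simp

theorem neg_exp_add_faceSeries :
    -(exp ℚ + faceSeries * exp ℚ ^ 2) = rescale (-1) weightSeries := by
  have h1 : exp ℚ * rescale (-1) (exp ℚ) = 1 := exp_mul_exp_neg_eq_one
  have h2 := congrArg (rescale (-1 : ℚ)) weightSeries_mul
  simp only [map_mul, map_sub, map_one, map_pow, rescale_X, map_ofNat, map_neg] at h2
  have h3 : (1 + 2 * X : ℚ⟦X⟧) ≠ 0 := fun h => by
    have := congrArg (constantCoeff (R := ℚ)) h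
    simp at this
  apply mul_left_cancel₀ h3
  set e := exp ℚ
  set e' := rescale (-1) e
  set T := rescale (-1) weightSeries
  -- The multiple of `h1` reduces `e ^ 2 * e' ^ 2` to `1` and `e ^ 2 * e'` to `e`, using `(e * e') ^
  -- 2 - 1 = (e * e' - 1) * (e * e' + 1)`.
  linear_combination -faceSeries_mul - e ^ 2 * h2 +
    (T * (1 + 2 * X) * (e * e' + 1) + X * e) * h1

open Nat in
theorem coeff_faceSeries_mul (f : ℕ → ℚ) (d : ℕ) :
    d ! * coeff d (faceSeries * PowerSeries.mk fun k => f k * 2 ^ k / k !) =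
      ∑ e ∈ range (d + 1), 2 ^ (d - e) * (d.choose e : ℚ) *
        (f (d - e) * (e ! * coeff e faceSeries)) := by
  rw [coeff_mul, Finset.Nat.sum_antidiagonal_eq_sum_range_succ_mk, Finset.mul_sum]
  refine Finset.sum_congr rfl fun e he => ?_
  have h : e ≤ d := Nat.lt_succ_iff.1 (Finset.mem_range.1 he)
  rw [coeff_mk, Nat.cast_choose ℚ h]
  field_simp

open Classical in
-- The system is unitriangular, `N x` having coefficient `1`, so it determines `N` by induction on
-- faces; by `faceSeries_mul` the scaled coefficients of `faceSeries` satisfy it too.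
theorem eq_coeff_faceSeries {n : ℕ} (N : CubeFace n → ℤ)
    (hN : ∀ x, ∑ p with p ≤ x, ((dim x - dim p + 1 : ℕ) : ℤ) * N p = -(dim x + 1))
    (x : CubeFace n) : (N x : ℚ) = (dim x).factorial * coeff (dim x) faceSeries := by
  induction x using WellFoundedLT.induction with
  | ind x ih =>
    have h1 : ∑ p with p ≤ x, ((dim x - dim p + 1 : ℕ) : ℚ) * (N p : ℚ) = -(dim x + 1) := by
      exact_mod_cast hN x
    have h2 := sum_faces x fun e => ((dim x - e + 1 : ℕ) : ℚ) * (e.factorial * coeff e faceSeries)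
    rw [← coeff_faceSeries_mul (fun k => ((k + 1 : ℕ) : ℚ))] at h2
    push_cast at h2
    rw [mk_add_one_mul_pow_div_factorial, show rescale (2 : ℚ) (exp ℚ) = exp ℚ ^ 2 from
      (exp_pow_eq_rescale_exp 2).symm, show (C 2 : ℚ⟦X⟧) = 2 from map_ofNat C 2, faceSeries_mul] at h2
    have h3 := mk_add_one_mul_pow_div_factorial 1
    simp only [map_one, one_mul, rescale_one, RingHom.id_apply, one_pow, mul_one] at h3
    rw [← h3, map_neg, coeff_mk] at h2
    have h4 : ((dim x).factorial : ℚ) * -(((dim x : ℚ) + 1) / (dim x).factorial) =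
        -(dim x + 1) := by
      field_simp
    rw [h4, ← h1] at h2
    push_cast at h2
    have hx : x ∈ Finset.univ.filter fun p => p ≤ x := by simp
    rw [← Finset.add_sum_erase _ _ hx, ← Finset.add_sum_erase _ _ hx] at h2
    have h5 : ∀ p ∈ (Finset.univ.filter fun p => p ≤ x).erase x,
        (((dim x - dim p : ℕ) : ℚ) + 1) * ((dim p).factorial * coeff (dim p) faceSeries) =
          (((dim x - dim p : ℕ) : ℚ) + 1) * (N p : ℚ) := by
      intro p hp
      rw [Finset.mem_erase, Finset.mem_filter] at hp
      rw [ih p (lt_of_le_of_ne hp.2.2 hp.1)]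
    rw [Finset.sum_congr rfl h5, add_left_inj] at h2
    simpa using h2.symm

theorem mobius_rees_cube_eq_coeff (n : ℕ) :
    (mobius (Rees (CubicalLattice n) (Fin (n + 1))) : ℚ) =
      n.factorial * ((-1) ^ n * coeff n weightSeries) := by
  classical
  obtain ⟨N, hN, hmu⟩ := exists_mobius_rees_cube_eq n
  -- Every face lies below the all-star face, so this evaluates the sum over the whole cube.
  have h1 := sum_faces (fun _ : Fin n => Coord.star) fun e => e.factorial * coeff e faceSeries
  have hle : ∀ p : CubeFace n, p ≤ fun _ => Coord.star := fun p i => Or.inr rfl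
  have hdim : dim (fun _ : Fin n => Coord.star) = n := by simp [dim]
  simp only [hle, Finset.filter_true, hdim] at h1
  have h2 := coeff_faceSeries_mul (fun _ => 1) n
  simp only [one_mul] at h2
  have h3 : PowerSeries.mk (fun k => (2 : ℚ) ^ k / k.factorial) = exp ℚ ^ 2 := by
    rw [exp_pow_eq_rescale_exp]
    ext k
    simp [coeff_rescale, div_eq_mul_inv]
  rw [← coeff_rescale, ← neg_exp_add_faceSeries, hmu]
  push_cast
  rw [Finset.sum_congr rfl fun p _ => eq_coeff_faceSeries N hN p, h1, ← h2, h3, map_neg, map_add,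
    coeff_exp]
  simp
  field_simp

theorem sum_composition_eq_coeff (n : ℕ) :
    ∑ c : {c : Composition n // 1 ≤ c.length ∧ c.length ≤ n},
        (2 : ℚ) ^ (n - c.1.blocksFun ⟨0, c.2.1⟩) *
          (Nat.multinomial Finset.univ c.1.blocksFun : ℚ) *
          (c.1.blocksFun ⟨0, c.2.1⟩ : ℚ) *
          ∏ i : Fin c.1.length with 1 ≤ i.val, ((c.1.blocksFun i : ℚ) - 1) =
      n.factorial * coeff n weightSeries := by
  rw [Finset.sum_congr rfl fun c _ => blocksWeight_eq c.1 c.2.1, ← Finset.mul_sum, weightSeries,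
    coeff_mk, ← Fintype.sum_subtype_add_sum_subtype
      (fun c : Composition n => 1 ≤ c.length ∧ c.length ≤ n) fun c => blocksWeight c.blocks]
  -- Only the empty composition of `0` is excluded, and `blocksWeight` vanishes on it.
  have h : ∀ c : {c : Composition n // ¬ (1 ≤ c.length ∧ c.length ≤ n)},
      blocksWeight c.1.blocks = 0 := by
    rintro ⟨c, hc⟩
    have h1 : c.blocks.length = 0 := by
      rw [c.blocks_length]
      have := c.length_le
      omega
    rw [List.eq_nil_of_length_eq_zero h1]
    rfl
  simp [h]

end ReesCube

theorem mainTheorem3 (n : ℕ) :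
    ReesCube.mobius (ReesCube.Rees (ReesCube.CubicalLattice n) (Fin (n + 1))) =
      (-1) ^ n * ∑ c : {c : Composition n // 1 ≤ c.length ∧ c.length ≤ n},
        2 ^ (n - c.1.blocksFun ⟨0, c.2.1⟩) *
          (Nat.multinomial Finset.univ c.1.blocksFun : ℤ) *
          (c.1.blocksFun ⟨0, c.2.1⟩ : ℤ) *
          ∏ i : Fin c.1.length with 1 ≤ i.val, ((c.1.blocksFun i : ℤ) - 1) := by
  have h := ReesCube.mobius_rees_cube_eq_coeff n
  rw [mul_left_comm, ← ReesCube.sum_composition_eq_coeff] at h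
  exact_mod_cast h
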